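/- Let $d$ be a positive integer. For a noncrossing partition $\pi$ of $[n]=\{1,\dots,n\}$ let $\pi'$ be its Kreweras dual: the partition of $\{1',\dots,n'\}$ (points placed on a circle in the cyclic order $1<1'<2<2'<\cdots<n<n'$) in which $i'$ and $j'$ lie in the same block if and only if no block of $\pi$ has elements on both sides of the chord from $i'$ to $j'$. Let $NC_n$ be the set of noncrossing partitions of $[n]$, and let $NC^d_n$ be the set of those $\pi\in NC_n$ such that every block of $\pi$ and every block of $\pi'$ has cardinality congruent to $1$ modulo $d$. Let $R$ be a commutative $\mathbb{Q}$-algebra and let $a(0)=1,a(1),a(2),\dots$ be a sequence in $R$. Put $a^*(k)=(-1)^k\binom{-1/d}{k}$ for $k\ge 0$ and, for $\pi\in NC^d_{dk+1}$, $$\mathrm{wt}(\pi)=\prod_{B\in\pi}a\!\left(\tfrac{|B|-1}{d}\right)\cdot\prod_{C'\in\pi'}a^*\!\left(\tfrac{|C'|-1}{d}\right)\cdot s^{(|\pi|-1)/d}\,t^{(|\pi'|-1)/d}\quad\text{with } s=t=1 .$$ Define the formal power series $$A(x)=\sum_{k\ge 0}a(k)x^k,\qquad B(x)=\sum_{k\ge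 0}\Bigl(\sum_{\pi\in NC^d_{dk+1}}\mathrm{wt}(\pi)\Bigr)x^k,$$ $\overline{A}(x)=1+x\,A(x)^d$ and $\overline{B}(x)=1+x\,B(x)^d$. Then $$\overline{B}(x)=\overline{A}\bigl(x\,\overline{B}(x)\bigr).$$ For $d=1$ this is Speicher's identity: with $f(n)=a(n-1)$ for $n\ge1$ (so $f(1)=1$), one has $$\overline{A}(x)=F(x):=1+\sum_{n\ge1}f(n)x^n\quad\text{and}\quad \overline{B}(x)=G(x):=1+\sum_{n\ge1}\Bigl(\sum_{\pi\in NC_n}\prod_{B\in\pi}f(|B|)\Bigr)x^n,$$ and hence $G(x)=F(x\,G(x))$. -/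

import Mathlib

namespace NCd

/-- A partition of `{0, …, n-1}` (the set `[n]`, shifted by one) is noncrossing if there are no two
different blocks `B`, `C` and elements `i < j < k < l` with `i, k ∈ B` and `j, l ∈ C`. -/
def IsNoncrossing {n : ℕ} (π : Finpartition (Finset.univ : Finset (Fin n))) : Prop :=
  ∀ B ∈ π.parts, ∀ C ∈ π.parts, B ≠ C →
    ¬ ∃ i ∈ B, ∃ j ∈ C, ∃ k ∈ B, ∃ l ∈ C, i < j ∧ j < k ∧ k < l

instance {n : ℕ} : DecidablePred (@IsNoncrossing n) := fun π => by
  unfold IsNoncrossing; infer_instance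

/-- The primed points `i'` sit on the circle in the order `0 < 0' < 1 < 1' < ⋯ < (n-1) < (n-1)'`.
The chord from `i'` to `j'` splits the unprimed points into the cyclic interval between `i'` and
`j'`, which is `(min i j, max i j]`, and its complement. The points `i'` and `j'` lie in the same
region of the complement of the convex hulls of the blocks exactly when every block stays on one
side of the chord. -/
def SameRegion {n : ℕ} (π : Finpartition (Finset.univ : Finset (Fin n))) (i j : Fin n) : Prop :=
  ∀ B ∈ π.parts,
    B ⊆ Finset.Ioc (min i j) (max i j) ∨ Disjoint B (Finset.Ioc (min i j) (max i j))

instance {n : ℕ} (π : Finpartition (Finset.univ : Finset (Fin n))) :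
    DecidableRel (SameRegion π) := fun i j => by
  unfold SameRegion; infer_instance

theorem sameRegion_iff {n : ℕ} (π : Finpartition (Finset.univ : Finset (Fin n))) (i j : Fin n) :
    SameRegion π i j ↔
      ∀ B ∈ π.parts, ∀ x ∈ B, ∀ y ∈ B, ((x ≤ i ↔ x ≤ j) ↔ (y ≤ i ↔ y ≤ j)) := by
  have key : ∀ x : Fin n, x ∈ Finset.Ioc (min i j) (max i j) ↔ ¬ (x ≤ i ↔ x ≤ j) := by
    intro x
    simp only [Finset.mem_Ioc, min_lt_iff, le_max_iff]
    rcases le_total i j with h | h <;> grind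
  unfold SameRegion
  refine forall₂_congr fun B _ => ?_
  constructor
  · rintro (h | h) x hx y hy
    · have h1 := (key x).1 (h hx)
      have h2 := (key y).1 (h hy)
      tauto
    · have h1 := (key x).not.1 (Finset.disjoint_left.1 h hx)
      have h2 := (key y).not.1 (Finset.disjoint_left.1 h hy)
      tauto
  · intro h
    by_cases hB : ∃ x ∈ B, x ∈ Finset.Ioc (min i j) (max i j)
    · obtain ⟨x, hx, hxI⟩ := hB
      left
      intro y hy
      have := h x hx y hy
      rw [key] at hxI ⊢
      tauto
    · right
      rw [Finset.disjoint_left]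
      exact fun x hx hxI => hB ⟨x, hx, hxI⟩

/-- The equivalence relation "lying in the same region" on the primed points. -/
def regionSetoid {n : ℕ} (π : Finpartition (Finset.univ : Finset (Fin n))) : Setoid (Fin n) where
  r := SameRegion π
  iseqv :=
    { refl := fun i => by simp [sameRegion_iff]
      symm := fun {i j} h => by
        rw [sameRegion_iff] at h ⊢
        intro B hB x hx y hy
        have := h B hB x hx y hy
        tauto
      trans := fun {i j k} h₁ h₂ => by
        rw [sameRegion_iff] at h₁ h₂ ⊢
        intro B hB x hx y hy
        have h1 := h₁ B hB x hx y hy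
        have h2 := h₂ B hB x hx y hy
        tauto }

instance {n : ℕ} (π : Finpartition (Finset.univ : Finset (Fin n))) :
    DecidableRel (regionSetoid π).r :=
  inferInstanceAs (DecidableRel (SameRegion π))

/-- The Kreweras dual `π'` of a (noncrossing) partition; the point `i'` is written as `i`. -/
def krewerasDual {n : ℕ} (π : Finpartition (Finset.univ : Finset (Fin n))) :
    Finpartition (Finset.univ : Finset (Fin n)) :=
  Finpartition.ofSetoid (regionSetoid π)

/-- `NC n`: the set of noncrossing partitions of an `n`-element set. -/
def noncrossing (n : ℕ) : Finset (Finpartition (Finset.univ : Finset (Fin n))) :=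
  {π | IsNoncrossing π}

/-- The set of `d`-indivisible noncrossing partitions of an `n`-element set: all blocks of `π` and
of its Kreweras dual have cardinality congruent to `1` modulo `d`. -/
def indivisible (d n : ℕ) : Finset (Finpartition (Finset.univ : Finset (Fin n))) :=
  {π ∈ noncrossing n | (∀ B ∈ π.parts, B.card ≡ 1 [MOD d]) ∧
    ∀ C ∈ (krewerasDual π).parts, C.card ≡ 1 [MOD d]}

section Series

variable {R : Type*} [CommRing R]

/-- The weight of a `d`-indivisible noncrossing partition. All divisions by `d` are exact there. -/
def wt (d : ℕ) (a aStar : ℕ → R) (s t : R) {n : ℕ}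
    (π : Finpartition (Finset.univ : Finset (Fin n))) : R :=
  (∏ B ∈ π.parts, a ((B.card - 1) / d)) *
    (∏ C ∈ (krewerasDual π).parts, aStar ((C.card - 1) / d)) *
    s ^ ((π.parts.card - 1) / d) * t ^ (((krewerasDual π).parts.card - 1) / d)

/-- The total weight of the `d`-indivisible noncrossing partitions of a `(d * k + 1)`-element
set. -/
def b (d : ℕ) (a aStar : ℕ → R) (s t : R) (k : ℕ) : R :=
  ∑ π ∈ indivisible d (d * k + 1), wt d a aStar s t π

/-- For `G(x) = ∑ g(k) x^k`, the power series `1 + x G(x)^d`. -/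
noncomputable def bar (d : ℕ) (g : ℕ → R) : PowerSeries R :=
  1 + PowerSeries.X * PowerSeries.mk g ^ d

/-- The sequence `(-1)^k * binom(-1/d, k)`. -/
noncomputable def rootCoeff (R : Type*) [CommRing R] [Algebra ℚ R] (d k : ℕ) : R :=
  algebraMap ℚ R ((-1) ^ k * Ring.choose (-1 / (d : ℚ)) k)

/-- The power series `1 + ∑_{n ≥ 1} f(n) x^n`. -/
noncomputable def onePlusSeries (f : ℕ → R) : PowerSeries R :=
  PowerSeries.mk fun n => if n = 0 then 1 else f n

/-- The sum over all noncrossing partitions of an `n`-element set of the product of the values of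
`f` at the block sizes. -/
def ncSum (f : ℕ → R) (n : ℕ) : R :=
  ∑ π ∈ noncrossing n, ∏ B ∈ π.parts, f B.card

end Series

end NCd

/-! A nonempty noncrossing partition is cut just after the predecessor of its last point in that
point's block. The two sides are then independent, so noncrossing partitions of `[n]` correspond to
binary trees with `n` nodes (`exists_blockLabel`, `blockLabel_injective`). Sizes of blocks and dual
blocks follow the cut (`dualLabel_eq_iff`, the `fiberCard` lemmas), and `sum_noncrossing` becomes a
sum over trees for any size weights `f`, `g` with value 1 at 0.

Giving the block and the dual block of the last point free weights `φ`, `ψ` makes the recursion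
linear in each of them. Solving it (`exists_treeSeries_eq`) yields the generating function `x U V`
with `U = ∑ f(k+1) (xV)^k` and `V = ∑ g(k+1) (xU)^k`.

For the `d`-indivisible weights, `U = A(x^d V^d)` and `V = (1 - x^d U^d)^(-1/d)`. The choice of `a*`
thus gives `V^d = 1 + x^d U^d V^d = Ā(x^d V^d)`, so `V^d = W(x^d)` for the unique solution of `W =
Ā(xW)`. Since `B(x^d) = UV`, also `B̄(x^d) = 1 + x^d U^d V^d = W(x^d)`, that is `B̄ = W`. -/

namespace NCd

/-! ### Noncrossing partitions and their duals encoded by binary trees. -/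

open BinaryTree

/-- The label of the block of `x` in the noncrossing partition encoded by a binary tree: the left
subtree of size `i` encodes the partition of `[0, i)`, the right subtree of size `j` that of
`[i, i + j)`, and the last point `i + j` is added to the block of `i - 1` (if `0 < i`). -/
def blockLabel : BinaryTree Unit → ℕ → ℕ
  | nil, x => x
  | node _ l r, x =>
    if x < l.numNodes then
      if blockLabel l x + 1 = l.numNodes then l.numNodes + r.numNodes else blockLabel l x
    else if x < l.numNodes + r.numNodes then l.numNodes + blockLabel r (x - l.numNodes)
    else x

/-- The label of the block of the Kreweras dual which contains `x'`. -/
def dualLabel : BinaryTree Unit → ℕ → ℕ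
  | nil, x => x
  | node _ l r, x =>
    if x < l.numNodes then
      if x + 1 = l.numNodes then x
      else if dualLabel l x + 1 = l.numNodes then l.numNodes + r.numNodes else dualLabel l x
    else if x < l.numNodes + r.numNodes then
      if dualLabel r (x - l.numNodes) + 1 = r.numNodes then
        if l.numNodes = 0 then r.numNodes else l.numNodes - 1
      else l.numNodes + dualLabel r (x - l.numNodes)
    else x

theorem blockLabel_lt (t : BinaryTree Unit) {x : ℕ} (hx : x < t.numNodes) :
    blockLabel t x < t.numNodes := by
  induction t generalizing x with
  | nil => simp at hx
  | node u l r hl hr =>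
    have hl' := @hl x
    have hr' := @hr (x - l.numNodes)
    simp only [blockLabel, numNodes] at hx ⊢
    grind

theorem dualLabel_lt (t : BinaryTree Unit) {x : ℕ} (hx : x < t.numNodes) :
    dualLabel t x < t.numNodes := by
  induction t generalizing x with
  | nil => simp at hx
  | node u l r hl hr =>
    have hl' := @hl x
    have hr' := @hr (x - l.numNodes)
    simp only [dualLabel, numNodes] at hx ⊢
    grind

theorem blockLabel_last (t : BinaryTree Unit) : blockLabel t (t.numNodes - 1) = t.numNodes - 1 := by
  cases t <;> simp [blockLabel, numNodes]

theorem dualLabel_last (t : BinaryTree Unit) : dualLabel t (t.numNodes - 1) = t.numNodes - 1 := by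
  cases t <;> simp [dualLabel, numNodes]

section Node

variable {l r : BinaryTree Unit} {u : Unit} {x y : ℕ}

theorem blockLabel_eq_iff_left (hx : x < l.numNodes) (hy : y < l.numNodes) :
    blockLabel (node u l r) x = blockLabel (node u l r) y ↔ blockLabel l x = blockLabel l y := by
  have h1 := blockLabel_lt l hx
  have h2 := blockLabel_lt l hy
  simp only [blockLabel]
  grind

theorem blockLabel_eq_iff_right (hx : x < r.numNodes) (hy : y < r.numNodes) :
    blockLabel (node u l r) (l.numNodes + x) = blockLabel (node u l r) (l.numNodes + y) ↔
      blockLabel r x = blockLabel r y := by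
  simp only [blockLabel]
  grind

theorem blockLabel_ne_left_right (hx : x < l.numNodes) (hy : y < r.numNodes) :
    blockLabel (node u l r) x ≠ blockLabel (node u l r) (l.numNodes + y) := by
  have h1 := blockLabel_lt l hx
  have h2 := blockLabel_lt r hy
  simp only [blockLabel]
  grind

theorem blockLabel_eq_last_left (hx : x < l.numNodes) :
    blockLabel (node u l r) x = blockLabel (node u l r) (l.numNodes + r.numNodes) ↔
      blockLabel l x = blockLabel l (l.numNodes - 1) := by
  have h1 := blockLabel_lt l hx
  rw [blockLabel_last l]
  simp only [blockLabel]
  grind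

theorem blockLabel_ne_last_right (hy : y < r.numNodes) :
    blockLabel (node u l r) (l.numNodes + y) ≠
      blockLabel (node u l r) (l.numNodes + r.numNodes) := by
  have h2 := blockLabel_lt r hy
  simp only [blockLabel]
  grind

end Node

theorem lt_node_cases {i j x : ℕ} (hx : x < i + j + 1) :
    x < i ∨ (∃ y < j, x = i + y) ∨ x = i + j := by
  by_cases h : x < i
  · exact .inl h
  · by_cases h' : x = i + j
    · exact .inr (.inr h')
    · exact .inr (.inl ⟨x - i, by omega, by omega⟩)

theorem blockLabel_noncrossing (t : BinaryTree Unit) {w x y z : ℕ} (hwx : w < x) (hxy : x < y)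
    (hyz : y < z) (hz : z < t.numNodes) (h₁ : blockLabel t w = blockLabel t y)
    (h₂ : blockLabel t x = blockLabel t z) : blockLabel t w = blockLabel t x := by
  induction t generalizing w x y z with
  | nil => simp [numNodes] at hz
  | node u l r hl hr =>
    simp only [numNodes] at hz
    by_cases hy : y < l.numNodes
    · have hx : x < l.numNodes := by omega
      have hw : w < l.numNodes := by omega
      rw [blockLabel_eq_iff_left hw hy] at h₁
      rw [blockLabel_eq_iff_left hw hx]
      rcases lt_node_cases hz with hz | ⟨z, hz', rfl⟩ | rfl
      · rw [blockLabel_eq_iff_left hx hz] at h₂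
        exact hl hwx hxy hyz hz h₁ h₂
      · exact absurd h₂ (blockLabel_ne_left_right hx hz')
      · rw [blockLabel_eq_last_left hx] at h₂
        rcases eq_or_lt_of_le (show y ≤ l.numNodes - 1 by omega) with rfl | hlt
        · rw [h₁, h₂]
        · exact hl hwx hxy hlt (by omega) h₁ h₂
    · obtain ⟨y, hy', rfl⟩ : ∃ y' < r.numNodes, y = l.numNodes + y' :=
        ⟨y - l.numNodes, by omega, by omega⟩
      rcases lt_node_cases (show w < l.numNodes + r.numNodes + 1 by omega) with
        hw | ⟨w, hw, rfl⟩ | rfl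
      · exact absurd h₁ (blockLabel_ne_left_right hw hy')
      · obtain ⟨x, hx', rfl⟩ : ∃ x' < r.numNodes, x = l.numNodes + x' :=
          ⟨x - l.numNodes, by omega, by omega⟩
        rw [blockLabel_eq_iff_right hw hy'] at h₁
        rw [blockLabel_eq_iff_right hw hx']
        rcases lt_node_cases hz with hz | ⟨z, hz', rfl⟩ | rfl
        · omega
        · rw [blockLabel_eq_iff_right hx' hz'] at h₂
          exact hr (by omega) (by omega) (by omega) hz' h₁ h₂
        · exact absurd h₂ (blockLabel_ne_last_right hx')
      · omega

/-- The partition determines the size of the left subtree: its last point is the predecessor of the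
final point in its block. A larger left subtree would join the final point to a point that the other
tree places on the right. -/
theorem blockLabel_left_numNodes_le {u u' : Unit} {l r l' r' : BinaryTree Unit}
    (hn : l.numNodes + r.numNodes = l'.numNodes + r'.numNodes)
    (h : ∀ x < l.numNodes + r.numNodes + 1, ∀ y < l.numNodes + r.numNodes + 1,
      (blockLabel (node u l r) x = blockLabel (node u l r) y ↔
        blockLabel (node u' l' r') x = blockLabel (node u' l' r') y)) :
    l.numNodes ≤ l'.numNodes := by
  by_contra! hlt
  have h1 := h (l.numNodes - 1) (by omega) (l.numNodes + r.numNodes) (by omega)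
  rw [blockLabel_eq_last_left (by omega)] at h1
  have h2 := h1.1 rfl
  rw [hn, show l.numNodes - 1 = l'.numNodes + (l.numNodes - 1 - l'.numNodes) by omega] at h2
  exact blockLabel_ne_last_right (by omega) h2

theorem blockLabel_injective {t t' : BinaryTree Unit} (hn : t.numNodes = t'.numNodes)
    (h : ∀ x < t.numNodes, ∀ y < t.numNodes,
      (blockLabel t x = blockLabel t y ↔ blockLabel t' x = blockLabel t' y)) : t = t' := by
  induction t generalizing t' with
  | nil =>
    cases t' with
    | nil => rfl
    | node => simp [numNodes] at hn
  | node u l r hl hr =>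
    cases t' with
    | nil => simp [numNodes] at hn
    | node u' l' r' =>
      simp only [numNodes] at hn h
      have e1 : l.numNodes = l'.numNodes :=
        le_antisymm (blockLabel_left_numNodes_le (by omega) h)
          (blockLabel_left_numNodes_le (by omega)
            fun x hx y hy => (h x (by omega) y (by omega)).symm)
      have e2 : r.numNodes = r'.numNodes := by omega
      have e3 : l = l' := hl e1 fun x hx y hy => by
        have := h x (by omega) y (by omega)
        rwa [blockLabel_eq_iff_left hx hy,
          blockLabel_eq_iff_left (by omega) (by omega)] at this
      have e4 : r = r' := hr e2 fun x hx y hy => by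
        have := h (l.numNodes + x) (by omega) (l.numNodes + y) (by omega)
        rwa [blockLabel_eq_iff_right hx hy, e1,
          blockLabel_eq_iff_right (by omega) (by omega)] at this
      rw [e3, e4]

/-- Every noncrossing equivalence relation (given as the kernel of `c`) is encoded by a tree. -/
theorem exists_blockLabel (n : ℕ) (c : ℕ → ℕ)
    (hc : ∀ w x y z, w < x → x < y → y < z → z < n → c w = c y → c x = c z → c w = c x) :
    ∃ t : BinaryTree Unit, t.numNodes = n ∧
      ∀ x < n, ∀ y < n, (blockLabel t x = blockLabel t y ↔ c x = c y) := by
  induction n using Nat.strong_induction_on generalizing c with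
  | _ n ih =>
  rcases n with _ | m
  · exact ⟨nil, rfl, by simp⟩
  -- Here `i - 1` is the predecessor of `m` in its class. If there is none, the empty supremum gives
  -- `i = 0`, an empty left subtree.
  obtain ⟨i, him, hi, hi'⟩ : ∃ i ≤ m, (0 < i → c (i - 1) = c m) ∧
      ∀ x < m, i ≤ x → c x ≠ c m := by
    refine ⟨((Finset.range m).filter fun b => c b = c m).sup (· + 1), ?_, ?_, ?_⟩
    · simp only [Finset.sup_le_iff, Finset.mem_filter, Finset.mem_range]
      omega
    · intro h0
      obtain ⟨b, hb, hb'⟩ := Finset.exists_mem_eq_sup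
        ((Finset.range m).filter fun b => c b = c m)
        (by by_contra h; rw [Finset.not_nonempty_iff_eq_empty] at h; simp [h] at h0) (· + 1)
      rw [hb']
      simpa using (Finset.mem_filter.1 hb).2
    · intro x hx hix hxm
      have : x + 1 ≤ _ := Finset.le_sup (f := (· + 1))
        (show x ∈ (Finset.range m).filter fun b => c b = c m by simp [hx, hxm])
      omega
  obtain ⟨j, rfl⟩ := Nat.exists_eq_add_of_le him
  obtain ⟨l, hl, hl'⟩ := ih i (by omega) c
    fun w x y z h1 h2 h3 h4 => hc w x y z h1 h2 h3 (by omega)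
  obtain ⟨r, hr, hr'⟩ := ih j (by omega) (fun x => c (i + x))
    fun w x y z h1 h2 h3 h4 => hc (i + w) (i + x) (i + y) (i + z) (by omega) (by omega) (by omega)
      (by omega)
  -- A class meeting both sides would cross the pair `i - 1`, `i + j`, hence contain `i + j`,
  -- against the choice of `i`.
  have hlr : ∀ x < i, ∀ y < j, c x ≠ c (i + y) := by
    intro x hx y hy hxy
    rcases eq_or_lt_of_le (show x ≤ i - 1 by omega) with h | h
    · exact hi' (i + y) (by omega) (by omega) (by rw [← hxy, h, hi (by omega)])
    · have := hc x (i - 1) (i + y) (i + j) h (by omega) (by omega) (by omega) hxy (hi (by omega))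
      exact hi' (i + y) (by omega) (by omega) (by rw [← hxy, this, hi (by omega)])
  refine ⟨node () l r, by simp [numNodes, hl, hr], ?_⟩
  subst hl hr
  intro x hx₀ y hy₀
  rcases lt_node_cases hx₀ with hx | ⟨x, hx, rfl⟩ | rfl <;>
  rcases lt_node_cases hy₀ with hy | ⟨y, hy, rfl⟩ | rfl
  · rw [blockLabel_eq_iff_left hx hy, hl' x hx y hy]
  · exact iff_of_false (blockLabel_ne_left_right hx hy) (hlr x hx y hy)
  · rw [blockLabel_eq_last_left hx, hl' x hx _ (by omega), hi (by omega)]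
  · exact iff_of_false (blockLabel_ne_left_right hy hx).symm (hlr y hy x hx).symm
  · rw [blockLabel_eq_iff_right hx hy, hr' x hx y hy]
  · exact iff_of_false (blockLabel_ne_last_right hx) (hi' _ (by omega) (by omega))
  · rw [eq_comm, blockLabel_eq_last_left hy, hl' y hy _ (by omega), hi (by omega), eq_comm]
  · exact iff_of_false (blockLabel_ne_last_right hy).symm (hi' _ (by omega) (by omega)).symm
  · simp

/-- Two primed points have the same dual label if and only if no block separates them. -/
theorem dualLabel_eq_iff (t : BinaryTree Unit) {x y : ℕ} (hx : x < t.numNodes)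
    (hy : y < t.numNodes) :
    dualLabel t x = dualLabel t y ↔
      ∀ p < t.numNodes, ∀ q < t.numNodes, blockLabel t p = blockLabel t q →
        ((p ≤ x ↔ p ≤ y) ↔ (q ≤ x ↔ q ≤ y)) := by
  induction t generalizing x y with
  | nil => simp [numNodes] at hx
  | node u l r hl hr =>
    simp only [numNodes] at hx hy ⊢
    set i := l.numNodes with hi
    set j := r.numNodes with hj
    -- The block relation is generated by the relations of the two sides and the single pair `i -
    -- 1`, `i + j`, so only these can separate.
    have key : (∀ p < i + j + 1, ∀ q < i + j + 1,
        blockLabel (node u l r) p = blockLabel (node u l r) q →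
          ((p ≤ x ↔ p ≤ y) ↔ (q ≤ x ↔ q ≤ y))) ↔
        (∀ p < i, ∀ q < i, blockLabel l p = blockLabel l q →
          ((p ≤ x ↔ p ≤ y) ↔ (q ≤ x ↔ q ≤ y))) ∧
        (∀ p < j, ∀ q < j, blockLabel r p = blockLabel r q →
          ((i + p ≤ x ↔ i + p ≤ y) ↔ (i + q ≤ x ↔ i + q ≤ y))) ∧
        (0 < i → ((i - 1 ≤ x ↔ i - 1 ≤ y) ↔ (i + j ≤ x ↔ i + j ≤ y))) := by
      constructor
      · intro h
        refine ⟨fun p hp q hq hpq => h p (by omega) q (by omega)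
          ((blockLabel_eq_iff_left hp hq).2 hpq), fun p hp q hq hpq => h _ (by omega) _ (by omega)
          ((blockLabel_eq_iff_right hp hq).2 hpq), fun h0 => h _ (by omega) _ (by omega)
          ((blockLabel_eq_last_left (by omega)).2 rfl)⟩
      · rintro ⟨h1, h2, h3⟩ p hp₀ q hq₀ hpq
        rcases lt_node_cases hp₀ with hp | ⟨p, hp, rfl⟩ | rfl <;>
        rcases lt_node_cases hq₀ with hq | ⟨q, hq, rfl⟩ | rfl
        · exact h1 p hp q hq ((blockLabel_eq_iff_left hp hq).1 hpq)
        · exact absurd hpq (blockLabel_ne_left_right hp hq)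
        · exact (h1 p hp _ (by omega) ((blockLabel_eq_last_left hp).1 hpq)).trans (h3 (by omega))
        · exact absurd hpq.symm (blockLabel_ne_left_right hq hp)
        · exact h2 p hp q hq ((blockLabel_eq_iff_right hp hq).1 hpq)
        · exact absurd hpq (blockLabel_ne_last_right hp)
        · exact ((h1 q hq _ (by omega) ((blockLabel_eq_last_left hq).1 hpq.symm)).trans
            (h3 (by omega))).symm
        · exact absurd hpq.symm (blockLabel_ne_last_right hq)
        · rfl
    -- Every position beyond the left part looks like its last primed point, hence the truncation at
    -- `i - 1`.
    have keyl : (∀ p < i, ∀ q < i, blockLabel l p = blockLabel l q →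
          ((p ≤ x ↔ p ≤ y) ↔ (q ≤ x ↔ q ≤ y))) ↔
        (0 < i → dualLabel l (min x (i - 1)) = dualLabel l (min y (i - 1))) := by
      rcases Nat.eq_zero_or_pos i with h0 | h0
      · simp [h0]
      · rw [hl (by omega) (by omega)]
        simp only [h0, true_imp_iff]
        refine forall₂_congr fun p hp => forall₂_congr fun q hq => imp_congr_right fun _ => ?_
        have a1 : ∀ z p, p < i → (p ≤ min z (i - 1) ↔ p ≤ z) := by omega
        rw [a1 _ _ hp, a1 _ _ hp, a1 _ _ hq, a1 _ _ hq]
    -- Positions before and after the right part both act as its last primed point: exchanging "no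
    -- point lies below" with "all points lie below" negates both sides of the outer equivalence.
    have keyr : (∀ p < j, ∀ q < j, blockLabel r p = blockLabel r q →
          ((i + p ≤ x ↔ i + p ≤ y) ↔ (i + q ≤ x ↔ i + q ≤ y))) ↔
        (0 < j → dualLabel r (if i ≤ x ∧ x < i + j then x - i else j - 1) =
          dualLabel r (if i ≤ y ∧ y < i + j then y - i else j - 1)) := by
      rcases Nat.eq_zero_or_pos j with h0 | h0
      · simp [h0]
      · rw [hr (by split_ifs <;> omega) (by split_ifs <;> omega)]
        simp only [h0, true_imp_iff]
        refine forall₂_congr fun p hp => forall₂_congr fun q hq => imp_congr_right fun _ => ?_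
        split_ifs <;> omega
    rw [key, keyl, keyr]
    have bl := fun x (hx : x < i) => dualLabel_lt l hx
    have br := fun x (hx : x < j) => dualLabel_lt r hx
    have el := dualLabel_last l
    have er := dualLabel_last r
    rw [← hi] at el
    rw [← hj] at er
    simp only [dualLabel, ← hi, ← hj]
    clear_value i j
    clear key keyl keyr hl hr
    rcases lt_node_cases hx with hx' | ⟨x, hx', rfl⟩ | rfl <;>
    rcases lt_node_cases hy with hy' | ⟨y, hy', rfl⟩ | rfl
    · grind
    · grind
    · grind
    · grind
    · grind
    · grind
    · grind
    · grind
    · grind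

end NCd

/-! ### Block and dual block sizes along the tree recursion. -/

namespace NCd

open BinaryTree

/-- The number of points in `[0, n)` with label `x`. -/
def fiberCard (c : ℕ → ℕ) (n x : ℕ) : ℕ := ∑ y ∈ Finset.range n, if c y = x then 1 else 0

theorem fiberCard_congr {c c' : ℕ → ℕ} {n x x' : ℕ} (h : ∀ y < n, (c y = x ↔ c' y = x')) :
    fiberCard c n x = fiberCard c' n x' :=
  Finset.sum_congr rfl fun y hy => by simp only [h y (Finset.mem_range.1 hy)]

theorem fiberCard_eq_zero {c : ℕ → ℕ} {n x : ℕ} (h : ∀ y < n, c y ≠ x) : fiberCard c n x = 0 :=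
  Finset.sum_eq_zero fun y hy => if_neg (h y (Finset.mem_range.1 hy))

theorem fiberCard_add_add_one (c : ℕ → ℕ) (i j x : ℕ) :
    fiberCard c (i + j + 1) x =
      fiberCard c i x + fiberCard (fun y => c (i + y)) j x + if c (i + j) = x then 1 else 0 := by
  rw [fiberCard, Finset.sum_range_succ, Finset.sum_range_add]
  rfl

/-- The size of the block of the last point. -/
def rootBlock : BinaryTree Unit → ℕ
  | nil => 0
  | node _ l _ => rootBlock l + 1

/-- The size of the dual block of the last primed point. -/
def rootDual : BinaryTree Unit → ℕ
  | nil => 0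
  | node _ l r => if l.numNodes = 0 then rootDual r + 1 else rootDual l

section Node

variable (u : Unit) (l r : BinaryTree Unit)

theorem fiberCard_blockLabel_left {x : ℕ} (hx : x + 1 < l.numNodes) :
    fiberCard (blockLabel (node u l r)) (node u l r).numNodes x =
      fiberCard (blockLabel l) l.numNodes x := by
  have h1 := fun y => @blockLabel_lt l y
  have h2 := fun y => @blockLabel_lt r y
  rw [numNodes, fiberCard_add_add_one,
    fiberCard_congr (c' := blockLabel l) (x' := x) (n := l.numNodes),
    fiberCard_eq_zero (n := r.numNodes), if_neg] <;> first | omega | (simp only [blockLabel]; grind)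

/-- The block of the last left point is relabelled by the new last point, so its old label is
vacated. Such empty fibres are harmless when the weight of size 0 is 1. -/
theorem fiberCard_blockLabel_left_last (hl : 0 < l.numNodes) :
    fiberCard (blockLabel (node u l r)) (node u l r).numNodes (l.numNodes - 1) = 0 := by
  have h1 := fun y => @blockLabel_lt l y
  have h2 := fun y => @blockLabel_lt r y
  rw [numNodes, fiberCard_eq_zero]
  simp only [blockLabel]
  grind

theorem fiberCard_blockLabel_right {x : ℕ} (hx : x < r.numNodes) :
    fiberCard (blockLabel (node u l r)) (node u l r).numNodes (l.numNodes + x) =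
      fiberCard (blockLabel r) r.numNodes x := by
  have h1 := fun y => @blockLabel_lt l y
  have h2 := fun y => @blockLabel_lt r y
  rw [numNodes, fiberCard_add_add_one, fiberCard_eq_zero (n := l.numNodes),
    fiberCard_congr (c' := blockLabel r) (x' := x) (n := r.numNodes), if_neg] <;>
    first | omega | (simp only [blockLabel]; grind)

theorem fiberCard_blockLabel_last (t : BinaryTree Unit) :
    fiberCard (blockLabel t) t.numNodes (t.numNodes - 1) = rootBlock t := by
  induction t with
  | nil => rfl
  | node u l r hl hr =>
    have h1 := fun y => @blockLabel_lt l y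
    have h2 := fun y => @blockLabel_lt r y
    rw [rootBlock, ← hl, numNodes, Nat.add_sub_cancel, fiberCard_add_add_one,
      fiberCard_congr (c' := blockLabel l) (x' := l.numNodes - 1) (n := l.numNodes),
      fiberCard_eq_zero (n := r.numNodes), if_pos] <;> first | omega | (simp only [blockLabel]; grind)

theorem fiberCard_dualLabel_left {x : ℕ} (hx : x + 1 < l.numNodes) :
    fiberCard (dualLabel (node u l r)) (node u l r).numNodes x =
      fiberCard (dualLabel l) l.numNodes x := by
  have h1 := fun y => @dualLabel_lt l y
  have h2 := fun y => @dualLabel_lt r y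
  have h3 := dualLabel_last l
  rw [numNodes, fiberCard_add_add_one,
    fiberCard_congr (c' := dualLabel l) (x' := x) (n := l.numNodes),
    fiberCard_eq_zero (n := r.numNodes), if_neg] <;> first | omega | (simp only [dualLabel]; grind)

theorem fiberCard_dualLabel_left_last (hl : 0 < l.numNodes) :
    fiberCard (dualLabel (node u l r)) (node u l r).numNodes (l.numNodes - 1) =
      fiberCard (dualLabel r) r.numNodes (r.numNodes - 1) + 1 := by
  have h1 := fun y => @dualLabel_lt l y
  have h2 := fun y => @dualLabel_lt r y
  have h3 := dualLabel_last l
  -- On the left, only the last point itself keeps this label; the rest of its old dual block passes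
  -- to the new last point.
  have h4 : fiberCard (dualLabel (node u l r)) l.numNodes (l.numNodes - 1) =
      fiberCard id l.numNodes (l.numNodes - 1) := by
    apply fiberCard_congr
    simp only [dualLabel, id]
    grind
  have h5 : fiberCard id l.numNodes (l.numNodes - 1) = 1 := by
    simp [fiberCard, hl]
  rw [numNodes, fiberCard_add_add_one, h4, h5,
    fiberCard_congr (c' := dualLabel r) (x' := r.numNodes - 1) (n := r.numNodes), if_neg] <;>
    first | omega | (simp only [dualLabel]; grind)

theorem fiberCard_dualLabel_right {x : ℕ} (hx : x + 1 < r.numNodes) :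
    fiberCard (dualLabel (node u l r)) (node u l r).numNodes (l.numNodes + x) =
      fiberCard (dualLabel r) r.numNodes x := by
  have h1 := fun y => @dualLabel_lt l y
  have h2 := fun y => @dualLabel_lt r y
  rw [numNodes, fiberCard_add_add_one, fiberCard_eq_zero (n := l.numNodes),
    fiberCard_congr (c' := dualLabel r) (x' := x) (n := r.numNodes), if_neg] <;>
    first | omega | (simp only [dualLabel]; grind)

/-- The last dual block of the right part takes the label of the last left point, or of the new last
point if the left part is empty. -/
theorem fiberCard_dualLabel_right_last (hr : 0 < r.numNodes) :
    fiberCard (dualLabel (node u l r)) (node u l r).numNodes (l.numNodes + (r.numNodes - 1)) =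
      0 := by
  have h1 := fun y => @dualLabel_lt l y
  have h2 := fun y => @dualLabel_lt r y
  rw [numNodes, fiberCard_eq_zero]
  simp only [dualLabel]
  grind

theorem fiberCard_dualLabel_last (t : BinaryTree Unit) :
    fiberCard (dualLabel t) t.numNodes (t.numNodes - 1) = rootDual t := by
  induction t with
  | nil => rfl
  | node u l r hl hr =>
    have h1 := fun y => @dualLabel_lt l y
    have h2 := fun y => @dualLabel_lt r y
    have h3 := dualLabel_last l
    rw [rootDual, ← hl, ← hr, numNodes, Nat.add_sub_cancel, fiberCard_add_add_one]
    have h4 : dualLabel (node u l r) (l.numNodes + r.numNodes) = l.numNodes + r.numNodes := by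
      simp [dualLabel]
    rw [if_pos h4]
    rcases Nat.eq_zero_or_pos l.numNodes with h0 | h0
    · rw [if_pos h0, fiberCard_eq_zero (n := l.numNodes),
        fiberCard_congr (c' := dualLabel r) (x' := r.numNodes - 1) (n := r.numNodes)] <;>
      first | omega | (simp only [dualLabel]; grind)
    · rw [if_neg h0.ne', fiberCard_eq_zero (n := r.numNodes)]
      -- In the last dual block, the new last point replaces the last left point `m`, so the size is
      -- unchanged.
      · obtain ⟨m, hm⟩ := Nat.exists_eq_add_of_lt h0
        rw [fiberCard, fiberCard, show Finset.range l.numNodes = Finset.range (m + 1) by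
          congr 1; omega, Finset.sum_range_succ, Finset.sum_range_succ, if_neg, if_pos]
        · rw [add_zero, add_zero]
          refine congrArg₂ (· + ·) (Finset.sum_congr rfl fun y hy => ?_) rfl
          have hy := Finset.mem_range.1 hy
          simp only [dualLabel]
          grind
        · grind
        · simp only [dualLabel]
          grind
      · simp only [dualLabel]
        grind

end Node

variable {R : Type*} [CommRing R] (f g : ℕ → R)

/-- The product of the weights of all blocks except the one of the last point. -/
def innerBlocks : BinaryTree Unit → R
  | nil => 1
  | node _ l r => innerBlocks l * innerBlocks r * f (rootBlock r)

/-- The product of the weights of all dual blocks except the one of the last primed point. -/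
def innerDuals : BinaryTree Unit → R
  | nil => 1
  | node _ l r =>
    innerDuals l * innerDuals r * if l.numNodes = 0 then 1 else g (rootDual r + 1)

variable {f g}

theorem prod_range_fiberCard_blockLabel (hf : f 0 = 1) (t : BinaryTree Unit) :
    ∏ x ∈ Finset.range (t.numNodes - 1), f (fiberCard (blockLabel t) t.numNodes x) =
      innerBlocks f t := by
  induction t with
  | nil => rfl
  | node u l r hl hr =>
    rw [innerBlocks, ← hl, ← hr, ← fiberCard_blockLabel_last r,
      show (node u l r).numNodes - 1 = l.numNodes + r.numNodes from rfl, Finset.prod_range_add,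
      mul_assoc]
    congr 1
    · rcases Nat.eq_zero_or_pos l.numNodes with h0 | h0
      · simp [h0]
      · obtain ⟨m, hm⟩ := Nat.exists_eq_add_of_lt h0
        have h1 := fiberCard_blockLabel_left_last u l r h0
        have hm' : l.numNodes - 1 = m := by omega
        rw [hm'] at h1 ⊢
        rw [show l.numNodes = m + 1 by omega, Finset.prod_range_succ, h1, hf, mul_one]
        refine Finset.prod_congr rfl fun x hx => ?_
        rw [fiberCard_blockLabel_left u l r (by have := Finset.mem_range.1 hx; omega), hm]
        simp
    · have h1 : ∀ x ∈ Finset.range r.numNodes,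
          f (fiberCard (blockLabel (node u l r)) (node u l r).numNodes (l.numNodes + x)) =
            f (fiberCard (blockLabel r) r.numNodes x) := fun x hx => by
        rw [fiberCard_blockLabel_right u l r (Finset.mem_range.1 hx)]
      rw [Finset.prod_congr rfl h1]
      rcases Nat.eq_zero_or_pos r.numNodes with h0 | h0
      -- For an empty right part, the factor `f (rootBlock r)` is `f 0 = 1`.
      · simp [h0, fiberCard, hf]
      · rw [← Finset.prod_range_succ (fun x => f (fiberCard (blockLabel r) r.numNodes x)),
          Nat.sub_add_cancel h0]

theorem prod_range_fiberCard_dualLabel (hg : g 0 = 1) (t : BinaryTree Unit) :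
    ∏ x ∈ Finset.range (t.numNodes - 1), g (fiberCard (dualLabel t) t.numNodes x) =
      innerDuals g t := by
  induction t with
  | nil => rfl
  | node u l r hl hr =>
    rw [innerDuals, ← hl, ← hr, ← fiberCard_dualLabel_last r,
      show (node u l r).numNodes - 1 = l.numNodes + r.numNodes from rfl, Finset.prod_range_add,
      mul_right_comm]
    congr 1
    · rcases Nat.eq_zero_or_pos l.numNodes with h0 | h0
      · simp [h0]
      · obtain ⟨m, hm⟩ := Nat.exists_eq_add_of_lt h0
        have h1 := fiberCard_dualLabel_left_last u l r h0
        have hm' : l.numNodes - 1 = m := by omega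
        rw [hm'] at h1 ⊢
        rw [if_neg h0.ne', show Finset.range l.numNodes = Finset.range (m + 1) by congr 1; omega,
          Finset.prod_range_succ, h1]
        congr 1
        refine Finset.prod_congr rfl fun x hx => ?_
        rw [fiberCard_dualLabel_left u l r (by have := Finset.mem_range.1 hx; omega)]
    · rcases Nat.eq_zero_or_pos r.numNodes with h0 | h0
      · simp [h0]
      · obtain ⟨m, hm⟩ := Nat.exists_eq_add_of_lt h0
        have h1 := fiberCard_dualLabel_right_last u l r h0
        have hm' : r.numNodes - 1 = m := by omega
        rw [hm'] at h1 ⊢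
        rw [show Finset.range r.numNodes = Finset.range (m + 1) by congr 1; omega,
          Finset.prod_range_succ, h1, hg, mul_one]
        refine Finset.prod_congr rfl fun x hx => ?_
        rw [fiberCard_dualLabel_right u l r (by have := Finset.mem_range.1 hx; omega)]

theorem prod_range_eq_inner_mul {w : ℕ → R} {n : ℕ} (hn : 0 < n) :
    ∏ x ∈ Finset.range n, w x = (∏ x ∈ Finset.range (n - 1), w x) * w (n - 1) := by
  rw [← Finset.prod_range_succ, Nat.sub_add_cancel hn]

end NCd

/-! ### Passage from finite partitions to labels and trees. -/

namespace NCd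

open BinaryTree

instance (n : ℕ) (c : ℕ → ℕ) : DecidableRel (Setoid.ker fun x : Fin n => c x) :=
  fun x y => inferInstanceAs (Decidable (c x = c y))

/-- The partition of `[n]` into the level sets of `c`. -/
def kerPartition (n : ℕ) (c : ℕ → ℕ) : Finpartition (Finset.univ : Finset (Fin n)) :=
  Finpartition.ofSetoid (Setoid.ker fun x : Fin n => c x)

theorem mem_part_kerPartition {n : ℕ} {c : ℕ → ℕ} {x y : Fin n} :
    y ∈ (kerPartition n c).part x ↔ c x = c y := by
  rw [kerPartition, Finpartition.mem_part_ofSetoid_iff_rel]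
  rfl

theorem mem_part_krewerasDual {n : ℕ} {π : Finpartition (Finset.univ : Finset (Fin n))}
    {x y : Fin n} : y ∈ (krewerasDual π).part x ↔ SameRegion π x y := by
  rw [krewerasDual, Finpartition.mem_part_ofSetoid_iff_rel]
  rfl

section Partition

variable {n : ℕ} {P Q : Finpartition (Finset.univ : Finset (Fin n))}

theorem mem_parts_iff_exists_part {B : Finset (Fin n)} :
    B ∈ P.parts ↔ ∃ x, P.part x = B := by
  constructor
  · intro hB
    obtain ⟨x, hx⟩ := P.nonempty_of_mem_parts hB
    exact ⟨x, P.part_eq_of_mem hB hx⟩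
  · rintro ⟨x, rfl⟩
    exact P.part_mem.2 (Finset.mem_univ x)

theorem finpartition_ext (h : ∀ x y, y ∈ P.part x ↔ y ∈ Q.part x) : P = Q := by
  have h' : ∀ x, P.part x = Q.part x := fun x => Finset.ext (h x)
  ext B
  simp only [mem_parts_iff_exists_part, h']

theorem isNoncrossing_iff :
    IsNoncrossing P ↔ ∀ w x y z : Fin n, w < x → x < y → y < z → y ∈ P.part w → z ∈ P.part x →
      x ∈ P.part w := by
  constructor
  · intro h w x y z hwx hxy hyz hy hz
    by_contra hx
    refine h (P.part w) (mem_parts_iff_exists_part.2 ⟨w, rfl⟩) (P.part x)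
      (mem_parts_iff_exists_part.2 ⟨x, rfl⟩) (fun e => hx ?_)
      ⟨w, ?_, x, ?_, y, hy, z, hz, hwx, hxy, hyz⟩
    · rw [e]; simp
    · simp
    · simp
  · rintro h B hB C hC hBC ⟨w, hw, x, hx, y, hy, z, hz, hwx, hxy, hyz⟩
    obtain rfl := P.part_eq_of_mem hB hw
    obtain rfl := P.part_eq_of_mem hC hx
    exact hBC ((P.part_eq_of_mem hB (h w x y z hwx hxy hyz hy hz)).symm)

theorem sameRegion_iff_part {i j : Fin n} :
    SameRegion P i j ↔ ∀ x y, y ∈ P.part x → ((x ≤ i ↔ x ≤ j) ↔ (y ≤ i ↔ y ≤ j)) := by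
  rw [sameRegion_iff]
  constructor
  · exact fun h x y hy => h _ (mem_parts_iff_exists_part.2 ⟨x, rfl⟩) x (by simp) y hy
  · intro h B hB x hx y hy
    obtain rfl := P.part_eq_of_mem hB hx
    exact h x y hy

/-- Blocks correspond to attained labels; every other label below `n` contributes `f 0 = 1`. -/
theorem prod_parts_eq_prod_fiberCard {R : Type*} [CommRing R] {f : ℕ → R} (hf : f 0 = 1)
    {c : ℕ → ℕ} (hc : ∀ x < n, c x < n) (hP : ∀ x y, y ∈ P.part x ↔ c x = c y) :
    ∏ B ∈ P.parts, f B.card = ∏ x ∈ Finset.range n, f (fiberCard c n x) := by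
  have hcard : ∀ v, (Finset.univ.filter fun y : Fin n => c y = v).card = fiberCard c n v := by
    intro v
    rw [Finset.card_filter, fiberCard, Finset.sum_range]
  have hpart : ∀ x, P.part x = Finset.univ.filter fun y : Fin n => c y = c x := by
    intro x
    ext y
    simp [hP, eq_comm]
  symm
  rw [← Finset.prod_subset (s₁ := Finset.univ.image fun x : Fin n => c x)]
  · refine Finset.prod_nbij (fun v => Finset.univ.filter fun y : Fin n => c y = v) ?_ ?_ ?_ ?_
    · intro v hv
      obtain ⟨x, -, rfl⟩ := Finset.mem_image.1 hv
      exact mem_parts_iff_exists_part.2 ⟨x, hpart x⟩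
    · intro v hv w hw h
      obtain ⟨x, -, rfl⟩ := Finset.mem_image.1 hv
      have : x ∈ Finset.univ.filter fun y : Fin n => c y = c x := by simp
      rw [show (Finset.univ.filter fun y : Fin n => c y = c x) = _ from h] at this
      simpa using this
    · intro B hB
      obtain ⟨x, rfl⟩ := mem_parts_iff_exists_part.1 hB
      exact ⟨c x, by simp, (hpart x).symm⟩
    · intro v _
      rw [hcard]
  · intro v hv
    obtain ⟨x, -, rfl⟩ := Finset.mem_image.1 hv
    exact Finset.mem_range.2 (hc x x.2)
  · intro v _ hv
    rw [← hcard, Finset.card_eq_zero.2, hf]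
    rw [Finset.filter_eq_empty_iff]
    exact fun x _ hx => hv (Finset.mem_image.2 ⟨x, Finset.mem_univ x, hx⟩)

end Partition

section Sum

variable {n : ℕ} {t : BinaryTree Unit}

theorem isNoncrossing_kerPartition_blockLabel (ht : t.numNodes = n) :
    IsNoncrossing (kerPartition n (blockLabel t)) := by
  rw [isNoncrossing_iff]
  intro w x y z hwx hxy hyz hy hz
  rw [mem_part_kerPartition] at *
  exact blockLabel_noncrossing t hwx hxy hyz (by omega) hy hz

theorem exists_kerPartition_blockLabel_eq {π : Finpartition (Finset.univ : Finset (Fin n))}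
    (hπ : IsNoncrossing π) :
    ∃ t : BinaryTree Unit, t.numNodes = n ∧ kerPartition n (blockLabel t) = π := by
  obtain ⟨c, hc⟩ : ∃ c : ℕ → ℕ, ∀ x y : Fin n, y ∈ π.part x ↔ c x = c y := by
    -- Any injective coding of blocks by numbers serves; the value 0 outside `[0, n)` is never
    -- compared.
    refine ⟨fun x => if h : x < n then Encodable.encode (π.part ⟨x, h⟩) else 0, fun x y => ?_⟩
    simp [π.mem_part_iff_part_eq_part (Finset.mem_univ _) (Finset.mem_univ _), eq_comm]
  obtain ⟨t, ht, h⟩ := exists_blockLabel n c fun w x y z hwx hxy hyz hz hwy hxz => by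
    have := isNoncrossing_iff.1 hπ ⟨w, by omega⟩ ⟨x, by omega⟩ ⟨y, by omega⟩ ⟨z, hz⟩ hwx hxy hyz
    simp only [hc] at this
    exact this hwy hxz
  refine ⟨t, ht, finpartition_ext fun x y => ?_⟩
  rw [mem_part_kerPartition, hc, h x x.2 y y.2]

theorem mem_part_krewerasDual_kerPartition (ht : t.numNodes = n) (x y : Fin n) :
    y ∈ (krewerasDual (kerPartition n (blockLabel t))).part x ↔ dualLabel t x = dualLabel t y := by
  rw [mem_part_krewerasDual, sameRegion_iff_part, dualLabel_eq_iff t (by omega) (by omega)]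
  simp only [mem_part_kerPartition, ht, Fin.le_def]
  exact ⟨fun h p hp q hq => h ⟨p, hp⟩ ⟨q, hq⟩, fun h p q => h p p.2 q q.2⟩

theorem sum_noncrossing {R : Type*} [CommRing R] {f g : ℕ → R} (hf : f 0 = 1) (hg : g 0 = 1)
    (hn : 0 < n) :
    ∑ π ∈ noncrossing n,
        (∏ B ∈ π.parts, f B.card) * ∏ C ∈ (krewerasDual π).parts, g C.card =
      ∑ t ∈ treesOfNumNodesEq n,
        f (rootBlock t) * g (rootDual t) * (innerBlocks f t * innerDuals g t) := by
  symm
  refine Finset.sum_nbij (fun t => kerPartition n (blockLabel t)) ?_ ?_ ?_ ?_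
  · intro t ht
    simpa [noncrossing] using
      isNoncrossing_kerPartition_blockLabel (mem_treesOfNumNodesEq.1 ht)
  · intro t ht t' ht' h
    have ht := mem_treesOfNumNodesEq.1 ht
    have ht' := mem_treesOfNumNodesEq.1 ht'
    refine blockLabel_injective (ht.trans ht'.symm) fun x hx y hy => ?_
    rw [ht] at hx hy
    rw [← mem_part_kerPartition (x := ⟨x, hx⟩) (y := ⟨y, hy⟩),
      ← mem_part_kerPartition (x := ⟨x, hx⟩) (y := ⟨y, hy⟩)]
    exact iff_of_eq (by rw [show kerPartition n (blockLabel t) = _ from h])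
  · intro π hπ
    obtain ⟨t, ht, rfl⟩ := exists_kerPartition_blockLabel_eq (by simpa [noncrossing] using hπ)
    exact ⟨t, mem_treesOfNumNodesEq.2 ht, rfl⟩
  · intro t ht
    have ht := mem_treesOfNumNodesEq.1 ht
    subst ht
    rw [prod_parts_eq_prod_fiberCard hf (fun x hx => blockLabel_lt t hx)
        fun x y => mem_part_kerPartition,
      prod_parts_eq_prod_fiberCard hg (fun x hx => dualLabel_lt t hx)
        (mem_part_krewerasDual_kerPartition rfl),
      prod_range_eq_inner_mul hn, prod_range_eq_inner_mul hn,
      prod_range_fiberCard_blockLabel hf, prod_range_fiberCard_dualLabel hg,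
      fiberCard_blockLabel_last, fiberCard_dualLabel_last]
    ring

end Sum

end NCd

/-! ### Generating functions and the system for `U` and `V`. -/

namespace NCd

open BinaryTree PowerSeries

variable {R : Type*} [CommRing R]

section TreeSeries

variable (f g φ ψ : ℕ → R)

/-- The sum over all trees with `n` nodes of the product of the weights of the blocks and dual
blocks, where those of the last point have the special weights `φ` and `ψ`. -/
def treeSum (n : ℕ) : R :=
  ∑ t ∈ treesOfNumNodesEq n,
    φ (rootBlock t) * ψ (rootDual t) * (innerBlocks f t * innerDuals g t)

theorem sum_treesOfNumNodesEq_succ {M : Type*} [AddCommMonoid M] (w : BinaryTree Unit → M)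
    (n : ℕ) :
    ∑ t ∈ treesOfNumNodesEq (n + 1), w t =
      ∑ ij ∈ Finset.HasAntidiagonal.antidiagonal n,
        ∑ l ∈ treesOfNumNodesEq ij.1, ∑ r ∈ treesOfNumNodesEq ij.2,
        w (node () l r) := by
  rw [treesOfNumNodesEq_succ, Finset.sum_biUnion]
  · refine Finset.sum_congr rfl fun ij _ => ?_
    rw [pairwiseNode, Finset.sum_map, Finset.sum_product]
    rfl
  · simp_rw [Set.PairwiseDisjoint, Set.Pairwise, Finset.disjoint_left]
    aesop

theorem treeSum_zero : treeSum f g φ ψ 0 = φ 0 * ψ 0 := by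
  simp [treeSum, rootBlock, rootDual, innerBlocks, innerDuals]

/-- With an empty left part, the last point is a singleton and its primed point enlarges the last
dual block of the right part. Otherwise it enlarges the last block of the left part, whose last dual
block keeps its size. The right part's last block then closes, as does its last dual block with one
left point added; these get the weights `f` and `g` shifted by one. -/
theorem treeSum_succ (n : ℕ) :
    treeSum f g φ ψ (n + 1) = ∑ ij ∈ Finset.HasAntidiagonal.antidiagonal n,
      if ij.1 = 0 then φ 1 * treeSum f g f (fun k => ψ (k + 1)) ij.2
      else treeSum f g (fun k => φ (k + 1)) ψ ij.1 * treeSum f g f (fun k => g (k + 1)) ij.2 := by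
  rw [treeSum, sum_treesOfNumNodesEq_succ]
  refine Finset.sum_congr rfl fun ij _ => ?_
  split_ifs with h
  · rw [h, treesOfNumNodesEq_zero, Finset.sum_singleton, treeSum, Finset.mul_sum]
    refine Finset.sum_congr rfl fun r _ => ?_
    simp only [rootBlock, rootDual, innerBlocks, innerDuals, numNodes, if_true]
    ring
  · rw [treeSum, treeSum, Finset.sum_mul_sum]
    refine Finset.sum_congr rfl fun l hl => Finset.sum_congr rfl fun r _ => ?_
    rw [mem_treesOfNumNodesEq] at hl
    simp only [rootBlock, rootDual, innerBlocks, innerDuals, hl, h, if_false]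
    ring

/-- The generating function of `treeSum` for nonempty trees. -/
def treeSeries : PowerSeries R := mk fun n => if n = 0 then 0 else treeSum f g φ ψ n

/-- The generating function of the noncrossing partitions with an additional primed point before
the first point. -/
def augmentedSeries : PowerSeries R := mk fun n => treeSum f g f (fun k => ψ (k + 1)) n

theorem augmentedSeries_eq (hf : f 0 = 1) :
    augmentedSeries f g ψ = C (ψ 1) + treeSeries f g f (fun k => ψ (k + 1)) := by
  ext n
  rcases n with _ | n
  · simp [augmentedSeries, treeSeries, treeSum_zero, hf]
  · simp [augmentedSeries, treeSeries]

theorem treeSeries_eq :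
    treeSeries f g φ ψ = X * (C (φ 1) * augmentedSeries f g ψ +
      treeSeries f g (fun k => φ (k + 1)) ψ * augmentedSeries f g g) := by
  ext n
  rcases n with _ | n
  · simp [treeSeries]
  · rw [coeff_succ_X_mul, map_add, coeff_mul, coeff_mul, ← Finset.sum_add_distrib, treeSeries,
      coeff_mk, if_neg (Nat.succ_ne_zero n), treeSum_succ]
    refine Finset.sum_congr rfl fun ij _ => ?_
    simp only [augmentedSeries, treeSeries, coeff_mk, coeff_C]
    split_ifs <;> ring

end TreeSeries

/-! ### Substitution: linear recursions and uniqueness of fixed points. -/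

section Subst

theorem hasSubst_of_constantCoeff {Y : PowerSeries R} (hY : constantCoeff Y = 0) : HasSubst Y :=
  HasSubst.of_constantCoeff_zero' hY

theorem subst_C' {Y : PowerSeries R} (c : R) : subst Y (C c) = C c := subst_C c

theorem subst_one {Y : PowerSeries R} : subst Y (1 : PowerSeries R) = 1 := by
  simpa using subst_C' (Y := Y) (1 : R)

theorem subst_mk_eq {Y : PowerSeries R} (hY : constantCoeff Y = 0) (χ : ℕ → R) :
    subst Y (mk χ) = C (χ 0) + Y * subst Y (mk fun k => χ (k + 1)) := by
  have hs := hasSubst_of_constantCoeff hY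
  have : mk χ = C (χ 0) + X * mk fun k => χ (k + 1) := by
    ext n
    rcases n with _ | n
    · simp
    · simp
  rw [this, subst_add hs, subst_mul hs, subst_X hs, subst_C']

theorem eq_zero_of_forall_X_pow_dvd {F : PowerSeries R} (h : ∀ n, X ^ n ∣ F) : F = 0 := by
  ext n
  exact X_pow_dvd_iff.1 (h (n + 1)) n (Nat.lt_succ_self n)

/-- A family of power series satisfying the recursion of a substitution is a substitution. -/
theorem eq_subst_mul_of_recursion {Y P : PowerSeries R} (hY : constantCoeff Y = 0)
    (T : (ℕ → R) → PowerSeries R)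
    (hT : ∀ φ, T φ = C (φ 1) * P + Y * T fun k => φ (k + 1)) (φ : ℕ → R) :
    T φ = subst Y (mk fun k => φ (k + 1)) * P := by
  obtain ⟨Z, hZ⟩ := X_dvd_iff.2 hY
  rw [← sub_eq_zero]
  refine eq_zero_of_forall_X_pow_dvd fun n => ?_
  induction n generalizing φ with
  | zero => simp
  | succ n ih =>
    -- The error for `φ` is `Y` times the error for the shifted sequence, so each unfolding gains a
    -- factor `X`.
    have : T φ - subst Y (mk fun k => φ (k + 1)) * P =
        Y * (T (fun k => φ (k + 1)) - subst Y (mk fun k => φ (k + 1 + 1)) * P) := by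
      rw [hT φ, subst_mk_eq hY]
      ring
    rw [this, pow_succ']
    exact mul_dvd_mul ⟨Z, hZ⟩ (ih _)

theorem X_pow_dvd_subst_sub_subst {Y Z : PowerSeries R} (hY : constantCoeff Y = 0)
    (hZ : constantCoeff Z = 0) {n : ℕ} (h : X ^ n ∣ Y - Z) (F : PowerSeries R) :
    X ^ n ∣ subst Y F - subst Z F := by
  rw [X_pow_dvd_iff]
  intro m hm
  rw [map_sub, coeff_subst' (hasSubst_of_constantCoeff hY),
    coeff_subst' (hasSubst_of_constantCoeff hZ), sub_eq_zero]
  refine finsum_congr fun k => ?_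
  congr 1
  rw [← sub_eq_zero, ← map_sub]
  exact X_pow_dvd_iff.1 (h.trans (sub_dvd_pow_sub_pow Y Z k)) m hm

/-- The map `W ↦ F(QW)` is an `X`-adic contraction, since `X` divides `Q`. -/
theorem eq_of_eq_subst_X_mul {F Q W W' : PowerSeries R} (hQ : constantCoeff Q = 0)
    (h : W = subst (Q * W) F) (h' : W' = subst (Q * W') F) : W = W' := by
  rw [← sub_eq_zero]
  refine eq_zero_of_forall_X_pow_dvd fun n => ?_
  induction n with
  | zero => simp
  | succ n ih =>
    rw [h, h']
    refine X_pow_dvd_subst_sub_subst (by simp [hQ]) (by simp [hQ]) ?_ F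
    rw [← mul_sub, pow_succ']
    exact mul_dvd_mul (X_dvd_iff.2 hQ) ih

theorem subst_expand {d : ℕ} (hd : d ≠ 0) {Y : PowerSeries R} (hY : constantCoeff Y = 0)
    (F : PowerSeries R) : subst Y (expand d hd F) = subst (Y ^ d) F := by
  rw [expand_apply, subst_comp_subst_apply (HasSubst.X_pow hd) (hasSubst_of_constantCoeff hY),
    subst_pow (hasSubst_of_constantCoeff hY), subst_X (hasSubst_of_constantCoeff hY)]

theorem expand_injective {d : ℕ} (hd : d ≠ 0) :
    Function.Injective (expand d hd : PowerSeries R → PowerSeries R) := by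
  intro F G h
  ext n
  rw [← coeff_expand_mul d hd F, h, coeff_expand_mul]

end Subst

/-- The generating function of noncrossing partitions, weighted by their blocks and dual blocks,
is `X * U * V`, where `U` and `V` count the two kinds of planted plane trees. -/
theorem exists_treeSeries_eq {f g : ℕ → R} (hf : f 0 = 1) :
    ∃ U V : PowerSeries R, U = subst (X * V) (mk fun k => f (k + 1)) ∧
      V = subst (X * U) (mk fun k => g (k + 1)) ∧ treeSeries f g f g = X * (U * V) := by
  set V := augmentedSeries f g g with hV
  set U := subst (X * V) (mk fun k => f (k + 1)) with hU
  -- For fixed `ψ` the recursion in `φ` has ratio `X * V`; inserting its solution for `φ = f` makes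
  -- the recursion in `ψ` one of ratio `X * U`.
  have h1 : ∀ φ ψ, treeSeries f g φ ψ =
      subst (X * V) (mk fun k => φ (k + 1)) * (X * augmentedSeries f g ψ) := by
    intro φ ψ
    refine eq_subst_mul_of_recursion (by simp) (fun φ => treeSeries f g φ ψ) (fun φ => ?_) φ
    rw [treeSeries_eq]
    ring
  have h2 : ∀ ψ, augmentedSeries f g ψ = subst (X * U) (mk fun k => ψ (k + 1)) * 1 := by
    intro ψ
    refine eq_subst_mul_of_recursion (by simp) (fun ψ => augmentedSeries f g ψ) (fun ψ => ?_) ψ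
    rw [augmentedSeries_eq f g ψ hf, h1]
    ring
  refine ⟨U, V, hU, by rw [hV, h2, mul_one], ?_⟩
  rw [h1, ← hV, ← hU]
  ring

/-- Existence of the solution of the functional equation. -/
theorem exists_eq_subst_X_mul (F : PowerSeries R) :
    ∃ W : PowerSeries R, W = subst (X * W) (1 + X * F) := by
  -- Constant dual weights 1 give `V = 1 / (1 - XU)` with `U = F(XV)`, so `V = 1 + XV F(XV)` is the
  -- desired solution.
  obtain ⟨U, V, hU, hV, -⟩ := exists_treeSeries_eq
    (f := fun k => if k = 0 then 1 else coeff (k - 1) F) (g := fun _ => 1) rfl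
  have hF : (mk fun k => if k + 1 = 0 then 1 else coeff (k + 1 - 1) F) = F := by
    ext n
    simp
  rw [hF] at hU
  refine ⟨V, ?_⟩
  have h1 : constantCoeff (X * V) = 0 := by simp
  have h2 : V = 1 + X * U * V := by
    conv_lhs => rw [hV, subst_mk_eq (by simp), ← hV]
    simp
  rw [subst_add (hasSubst_of_constantCoeff h1), subst_mul (hasSubst_of_constantCoeff h1),
    subst_X (hasSubst_of_constantCoeff h1), subst_one, ← hU]
  conv_lhs => rw [h2]
  ring

/-- The series is `(1 - X)^(-1/d)` by the binomial theorem; the factor `(-1)^k` is the rescaling `X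
↦ -X`. -/
theorem mk_rootCoeff_pow_mul [Algebra ℚ R] {d : ℕ} (hd : d ≠ 0) :
    (mk (rootCoeff R d)) ^ d * (1 - X) = 1 := by
  have h1 : ∀ n : ℕ, PowerSeries.binomialSeries ℚ (-1 / (d : ℚ)) ^ n =
      PowerSeries.binomialSeries ℚ (n * (-1 / (d : ℚ))) := by
    intro n
    induction n with
    | zero => simp
    | succ n ih => rw [pow_succ, ih, ← binomialSeries_add]; congr 1; push_cast; ring
  have h2 : PowerSeries.binomialSeries ℚ (-1 / (d : ℚ)) ^ d * (1 + X) = 1 := by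
    have h3 := binomialSeries_nat (R := ℚ) (A := ℚ) 1
    rw [pow_one] at h3
    rw [h1, ← h3, ← binomialSeries_add]
    have : (d : ℚ) * (-1 / d) + (1 : ℕ) = 0 := by
      have : (d : ℚ) ≠ 0 := by exact_mod_cast hd
      field_simp
      simp
    rw [this, binomialSeries_zero]
  have h4 : mk (rootCoeff R d) =
      map (algebraMap ℚ R) (rescale (-1) (PowerSeries.binomialSeries ℚ (-1 / (d : ℚ)))) := by
    ext n
    simp [rootCoeff, coeff_rescale]
  have h5 := congrArg (fun F => map (algebraMap ℚ R) (rescale (-1) F)) h2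
  simp only [map_mul, map_pow, map_add, map_one] at h5
  rw [← h4] at h5
  simpa [rescale_X, sub_eq_add_neg] using h5

end NCd

/-! ### The `d`-indivisible weights, the functional equation and the case `d = 1`. -/

namespace NCd

open BinaryTree PowerSeries

variable {R : Type*} [CommRing R]

/-- The weight of block sizes which extends `k ↦ a k` on sizes `d * k + 1` by zero. -/
def sizeWeight (d : ℕ) (a : ℕ → R) (m : ℕ) : R :=
  if m = 0 then 1 else if m ≡ 1 [MOD d] then a ((m - 1) / d) else 0

theorem mk_sizeWeight_succ {d : ℕ} (hd : d ≠ 0) (a : ℕ → R) :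
    (mk fun k => sizeWeight d a (k + 1)) = expand d hd (mk a) := by
  ext n
  simp [sizeWeight, coeff_expand]

theorem prod_sizeWeight {n d : ℕ} (P : Finpartition (Finset.univ : Finset (Fin n)))
    (a : ℕ → R) :
    ∏ B ∈ P.parts, sizeWeight d a B.card =
      if ∀ B ∈ P.parts, B.card ≡ 1 [MOD d] then ∏ B ∈ P.parts, a ((B.card - 1) / d) else 0 := by
  have h0 : ∀ B ∈ P.parts, B.card ≠ 0 := fun B hB =>
    Finset.card_ne_zero.2 (P.nonempty_of_mem_parts hB)
  split_ifs with h
  · exact Finset.prod_congr rfl fun B hB => by rw [sizeWeight, if_neg (h0 B hB), if_pos (h B hB)]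
  · push Not at h
    obtain ⟨B, hB, hB'⟩ := h
    exact Finset.prod_eq_zero hB (by rw [sizeWeight, if_neg (h0 B hB), if_neg hB'])

theorem b_eq_coeff_treeSeries (d : ℕ) (a aStar : ℕ → R) (k : ℕ) :
    b d a aStar 1 1 k = coeff (d * k + 1) (treeSeries (sizeWeight d a) (sizeWeight d aStar)
      (sizeWeight d a) (sizeWeight d aStar)) := by
  rw [treeSeries, coeff_mk, if_neg (Nat.succ_ne_zero _), treeSum,
    ← sum_noncrossing rfl rfl (Nat.succ_pos _), b, indivisible, Finset.sum_filter]
  refine Finset.sum_congr rfl fun π _ => ?_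
  rw [prod_sizeWeight, prod_sizeWeight]
  simp only [wt, one_pow, mul_one]
  split_ifs <;> simp_all

theorem subst_one_add_X_mul_pow {Y : PowerSeries R} (hY : constantCoeff Y = 0)
    (F : PowerSeries R) (d : ℕ) : subst Y (1 + X * F ^ d) = 1 + Y * subst Y F ^ d := by
  have hs := hasSubst_of_constantCoeff hY
  rw [subst_add hs, subst_one, subst_mul hs, subst_X hs, subst_pow hs]

theorem expand_subst_eq {d : ℕ} (hd : d ≠ 0) {Y : PowerSeries R} (hY : constantCoeff Y = 0)
    (F : PowerSeries R) : expand d hd (subst Y F) = subst (expand d hd Y) F := by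
  rw [expand_apply, expand_apply,
    subst_comp_subst_apply (hasSubst_of_constantCoeff hY) (HasSubst.X_pow hd)]

theorem bar_b_eq_subst [Algebra ℚ R] {d : ℕ} (hd : d ≠ 0) (a : ℕ → R) :
    bar d (b d a (rootCoeff R d) 1 1) =
      subst (X * bar d (b d a (rootCoeff R d) 1 1)) (bar d a) := by
  obtain ⟨U, V, hU, hV, hS⟩ := exists_treeSeries_eq (f := sizeWeight d a)
    (g := sizeWeight d (rootCoeff R d)) rfl
  rw [mk_sizeWeight_succ hd, subst_expand hd (by simp), mul_pow] at hU hV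
  obtain ⟨W, hW⟩ := exists_eq_subst_X_mul (mk a ^ d)
  have hX : constantCoeff (X ^ d : PowerSeries R) = 0 := by simp [hd]
  have hW' : W = 1 + X * W * subst (X * W) (mk a) ^ d := by
    rw [← subst_one_add_X_mul_pow (by simp), ← hW]
  have hVd : V ^ d * (1 - X ^ d * U ^ d) = 1 := by
    have hs : HasSubst (X ^ d * U ^ d) := hasSubst_of_constantCoeff (by simp [hX])
    have h := congrArg (subst (X ^ d * U ^ d)) (mk_rootCoeff_pow_mul (R := R) hd)
    rwa [subst_mul hs, subst_pow hs, subst_sub hs, subst_X hs, subst_one, ← hV] at h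
  -- Both sides solve `Z = Ā(X^d Z)`, whose solution is unique.
  have hVW : V ^ d = expand d hd W := by
    refine eq_of_eq_subst_X_mul (F := 1 + X * mk a ^ d) hX ?_ ?_
    · rw [subst_one_add_X_mul_pow (by simp [hX]), ← hU]
      linear_combination hVd
    · conv_lhs => rw [hW]
      rw [expand_subst_eq hd (by simp), map_mul, expand_X]
  have hU' : U = expand d hd (subst (X * W) (mk a)) := by
    rw [expand_subst_eq hd (by simp), map_mul, expand_X, ← hVW]
    exact hU
  set U₀ : PowerSeries R := subst (X * W) (mk a) with hU₀
  -- Now that `U` is known to be a series in `X^d`, so is `V`, and the problem descends from `X^d`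
  -- to `X`.
  obtain ⟨V₀, hV'⟩ : ∃ V₀, V = expand d hd V₀ := by
    refine ⟨subst (X * U₀ ^ d) (mk (rootCoeff R d)), ?_⟩
    rw [expand_subst_eq hd (by simp), map_mul, map_pow, expand_X, ← hU']
    exact hV
  have hVW₀ : V₀ ^ d = W := expand_injective hd (by rw [map_pow, ← hV', hVW])
  have hb : mk (b d a (rootCoeff R d) 1 1) = U₀ * V₀ := by
    ext k
    rw [coeff_mk, b_eq_coeff_treeSeries, hS, coeff_succ_X_mul, hU', hV', ← map_mul,
      coeff_expand_mul]
  have hbar : bar d (b d a (rootCoeff R d) 1 1) = W := by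
    rw [bar, hb, mul_pow, hVW₀]
    linear_combination -hW'
  rw [hbar, bar]
  exact hW

theorem bar_one_eq_onePlusSeries (a : ℕ → R) : bar 1 a = onePlusSeries fun n => a (n - 1) := by
  ext n
  rcases n with _ | n <;> simp [bar, onePlusSeries, coeff_succ_X_mul, coeff_one]

theorem rootCoeff_one [Algebra ℚ R] (k : ℕ) : rootCoeff R 1 k = 1 := by
  rw [rootCoeff]
  have : Ring.choose (-1 / ((1 : ℕ) : ℚ)) k = (-1) ^ k := by
    have h := Ring.choose_neg (1 : ℚ) k
    simp only [add_sub_cancel_left] at h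
    simp [h, Ring.choose_natCast, Units.smul_def]
  rw [this, ← mul_pow]
  simp

theorem b_one_eq_ncSum [Algebra ℚ R] (a : ℕ → R) (k : ℕ) :
    b 1 a (rootCoeff R 1) 1 1 k = ncSum (fun n => a (n - 1)) (k + 1) := by
  -- Congruences modulo 1 are vacuous, and for `d = 1` all dual weights equal 1.
  have h : ∀ n, indivisible 1 n = noncrossing n := fun n => by
    simp [indivisible, Nat.modEq_one]
  rw [b, h, one_mul, ncSum]
  simp [wt, rootCoeff_one]

theorem bar_b_one [Algebra ℚ R] (a : ℕ → R) :
    bar 1 (b 1 a (rootCoeff R 1) 1 1) = onePlusSeries (ncSum fun n => a (n - 1)) := by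
  rw [bar_one_eq_onePlusSeries]
  ext n
  rcases n with _ | n
  · simp [onePlusSeries]
  · simp [onePlusSeries, b_one_eq_ncSum]

end NCd

theorem mainTheorem5 {R : Type*} [CommRing R] [Algebra ℚ R]
    (d : ℕ) (hd : 0 < d) (a : ℕ → R) (ha : a 0 = 1) :
    NCd.bar d (NCd.b d a (NCd.rootCoeff R d) 1 1) =
        PowerSeries.subst (PowerSeries.X * NCd.bar d (NCd.b d a (NCd.rootCoeff R d) 1 1))
          (NCd.bar d a) ∧
      (d = 1 →
        NCd.bar d a = NCd.onePlusSeries (fun n => a (n - 1)) ∧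
        NCd.bar d (NCd.b d a (NCd.rootCoeff R d) 1 1) =
          NCd.onePlusSeries (NCd.ncSum fun n => a (n - 1)) ∧
        NCd.onePlusSeries (NCd.ncSum fun n => a (n - 1)) =
          PowerSeries.subst
            (PowerSeries.X * NCd.onePlusSeries (NCd.ncSum fun n => a (n - 1)))
            (NCd.onePlusSeries fun n => a (n - 1))) := by
  refine ⟨NCd.bar_b_eq_subst hd.ne' a, ?_⟩
  rintro rfl
  refine ⟨NCd.bar_one_eq_onePlusSeries a, NCd.bar_b_one a, ?_⟩
  rw [← NCd.bar_b_one, ← NCd.bar_one_eq_onePlusSeries]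
  exact NCd.bar_b_eq_subst one_ne_zero a
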